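/- Let $d,m\in\mathbb N$, let $\xi$ be a random vector in $\mathbb R^d$ with distribution $F=\mathcal L(\xi)$ (an arbitrary Borel probability measure on $\mathbb R^d$), and let $t_1,\dots,t_m\in\mathbb R^d$. Let $F^n$ denote the $n$-fold convolution power of $F$, and let $\mathfrak X(t_1,\dots,t_m)$ be the collection of all convex polyhedra of the form $$X=\{x\in\mathbb R^d:\ a_j\le\langle x,t_j\rangle\le b_j,\ j=1,\dots,m\},\qquad -\infty\le a_j\le b_j\le\infty .$$ Suppose that, for each $j=1,\dots,m$, the distribution of the random variable $\langle\xi,t_j\rangle$ is either non-degenerate (that is, not concentrated at a single point) or equal to the point mass at $0$. Then there is a constant $c=c(F,t_1,\dots,t_m)>0$, depending only on $F$ and $t_1,\dots,t_m$, such that for all integers $n\ge 1$ and all $X\in\mathfrak X(t_1,\dots,t_m)$, $$\bigl|F^n\{X\}-F^{n+1}\{X\}\bigr|\le c\,n^{-1/2}.$$ -/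

import Mathlib

open MeasureTheory

/-- The convolution powers of a measure: the zeroth power is the point mass at the origin, and
each further power convolves once more with the measure. -/
noncomputable def convPow {E : Type*} [AddMonoid E] [MeasurableSpace E]
    (F : Measure E) : ℕ → Measure E
  | 0 => Measure.dirac 0
  | n + 1 => Measure.conv (convPow F n) F

/-- If `F` is the distribution of a random vector `ξ`, then `projLaw F t` is the distribution
of the real random variable `⟨ξ, t⟩`. -/
noncomputable def projLaw {d : ℕ} (F : Measure (EuclideanSpace ℝ (Fin d)))
    (t : EuclideanSpace ℝ (Fin d)) : Measure ℝ :=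
  F.map (fun x => inner ℝ x t)

/-- A distribution on the line is degenerate if it is concentrated at a single point. -/
def IsDegenerate (μ : Measure ℝ) : Prop :=
  ∃ a : ℝ, μ = Measure.dirac a

/-- The collection of convex polyhedra `{x : a j ≤ ⟨x, t j⟩ ≤ b j for all j}`, where
`-∞ ≤ a j ≤ b j ≤ ∞`. -/
def polyhedra {d m : ℕ} (t : Fin m → EuclideanSpace ℝ (Fin d)) :
    Set (Set (EuclideanSpace ℝ (Fin d))) :=
  {X | ∃ a b : Fin m → EReal, (∀ j, a j ≤ b j) ∧
    X = {x | ∀ j, a j ≤ ((inner ℝ x (t j) : ℝ) : EReal) ∧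
      ((inner ℝ x (t j) : ℝ) : EReal) ≤ b j}}

/-- The symmetrization of a measure: the law of the difference of two independent copies. -/
noncomputable def symmLaw (μ : Measure ℝ) : Measure ℝ :=
  (μ.prod μ).map (fun p => p.1 - p.2)

/-- The uniform distribution on the unit interval. -/
noncomputable def unitUniform : Measure ℝ := volume.restrict (Set.Ioc 0 1)

instance : IsProbabilityMeasure unitUniform := ⟨by simp [unitUniform]⟩

instance (μ : Measure ℝ) [IsProbabilityMeasure μ] : IsProbabilityMeasure (symmLaw μ) :=
  Measure.isProbabilityMeasure_map (by fun_prop)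

theorem charFun_symmLaw (μ : Measure ℝ) [IsProbabilityMeasure μ] (t : ℝ) :
    charFun (symmLaw μ) t = ((‖charFun μ t‖ ^ 2 : ℝ) : ℂ) := by
  rw [charFun_apply_real, symmLaw, integral_map (by fun_prop) (by fun_prop)]
  have h (p : ℝ × ℝ) : Complex.exp (t * ((p.1 - p.2 : ℝ) : ℂ) * Complex.I)
      = Complex.exp (t * (p.1 : ℂ) * Complex.I)
        * Complex.exp (((-t : ℝ) : ℂ) * (p.2 : ℂ) * Complex.I) := by
    rw [← Complex.exp_add]; congr 1; push_cast; ring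
  simp_rw [h]
  rw [integral_prod_mul (f := fun x : ℝ => Complex.exp (t * (x : ℂ) * Complex.I))
    (g := fun x : ℝ => Complex.exp (((-t : ℝ) : ℂ) * (x : ℂ) * Complex.I)),
    ← charFun_apply_real, ← charFun_apply_real, charFun_neg, Complex.mul_conj,
    Complex.normSq_eq_norm_sq]

theorem one_sub_norm_charFun_sq (μ : Measure ℝ) [IsProbabilityMeasure μ] (t : ℝ) :
    1 - ‖charFun μ t‖ ^ 2 = ∫ x, (1 - Real.cos (t * x)) ∂(symmLaw μ) := by
  have hi : Integrable (fun x : ℝ => Complex.exp (t * (x : ℂ) * Complex.I)) (symmLaw μ) := by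
    refine Integrable.of_bound (by fun_prop) 1 (.of_forall fun x => ?_)
    rw [← Complex.ofReal_mul, Complex.norm_exp_ofReal_mul_I]
  have h1 : ∫ x, Real.cos (t * x) ∂(symmLaw μ) = ‖charFun μ t‖ ^ 2 := by
    have := congrArg Complex.re (charFun_symmLaw μ t)
    rw [Complex.ofReal_re, charFun_apply_real, ← RCLike.re_eq_complex_re, ← integral_re hi] at this
    rw [← this]
    congr 1 with x
    rw [RCLike.re_eq_complex_re, ← Complex.ofReal_mul, Complex.exp_ofReal_mul_I_re]
  rw [integral_sub (integrable_const _), h1]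
  · simp
  · refine Integrable.of_bound (by fun_prop) 1 (.of_forall fun x => ?_)
    simpa using Real.abs_cos_le_one _

theorem norm_charFun_le_exp (μ : Measure ℝ) [IsProbabilityMeasure μ] (t : ℝ) :
    ‖charFun μ t‖ ≤ Real.exp (-(1 / 2) * ∫ x, (1 - Real.cos (t * x)) ∂(symmLaw μ)) := by
  rw [← one_sub_norm_charFun_sq]
  refine le_of_sq_le_sq ?_ (Real.exp_nonneg _)
  rw [← Real.exp_nat_mul]
  have := Real.add_one_le_exp (((2 : ℕ) : ℝ) * (-(1 / 2) * (1 - ‖charFun μ t‖ ^ 2)))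
  refine le_trans (le_of_eq ?_) this
  push_cast; ring

theorem norm_integral_charFun_le (μ τ : Measure ℝ) [IsProbabilityMeasure μ]
    [IsProbabilityMeasure τ] (a r : ℝ) :
    ‖∫ x, charFun τ (r * (x - a)) ∂μ‖ ≤ ∫ s, ‖charFun μ (r * s)‖ ∂τ := by
  have h : ∫ x, charFun τ (r * (x - a)) ∂μ
      = ∫ s, Complex.exp (((-(r * s * a) : ℝ) : ℂ) * Complex.I) * charFun μ (r * s) ∂τ := by
    simp_rw [charFun_apply_real]
    rw [integral_integral_swap]
    · congr 1 with s
      rw [← integral_const_mul]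
      congr 1 with x
      rw [← Complex.exp_add]; congr 1; push_cast; ring
    · refine Integrable.of_bound (by fun_prop) 1 (.of_forall fun x => ?_)
      simp only [Function.uncurry]
      rw [← Complex.ofReal_mul, Complex.norm_exp_ofReal_mul_I]
  rw [h]
  refine (norm_integral_le_integral_norm _).trans (le_of_eq ?_)
  congr 1 with s
  rw [norm_mul, Complex.norm_exp_ofReal_mul_I, one_mul]

theorem half_le_norm_charFun_unitUniform {x : ℝ} (hx : |x| ≤ 1) :
    1 / 2 ≤ ‖charFun unitUniform x‖ := by
  refine le_trans ?_ (Complex.re_le_norm _)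
  have hi : Integrable (fun t : ℝ => Complex.exp (x * (t : ℂ) * Complex.I)) unitUniform := by
    refine Integrable.of_bound (by fun_prop) 1 (.of_forall fun x => ?_)
    rw [← Complex.ofReal_mul, Complex.norm_exp_ofReal_mul_I]
  rw [charFun_apply_real, ← RCLike.re_eq_complex_re, ← integral_re hi]
  have h : ∫ _, (1 / 2 : ℝ) ∂unitUniform = 1 / 2 := by simp
  rw [← h]
  refine integral_mono_ae (integrable_const _) hi.re ?_
  filter_upwards [ae_restrict_mem (μ := volume) (measurableSet_Ioc (a := (0 : ℝ)) (b := 1))]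
    with t ht
  simp only [RCLike.re_eq_complex_re]
  rw [← Complex.ofReal_mul, Complex.exp_ofReal_mul_I_re]
  have h1 := Real.one_sub_sq_div_two_le_cos (x := x * t)
  have h2 : |x * t| ≤ 1 := by
    rw [abs_mul, abs_of_pos ht.1]
    exact mul_le_one₀ hx ht.1.le ht.2
  have h3 := (sq_le_one_iff_abs_le_one (x * t)).2 h2
  linarith

/-- Esseen's smoothing inequality for concentration. -/
theorem measureReal_Icc_le_integral_charFun (μ : Measure ℝ) [IsProbabilityMeasure μ]
    (a : ℝ) {l : ℝ} (hl : 0 < l) :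
    μ.real (Set.Icc (a - l) (a + l))
      ≤ 4 * ∫ s, ‖charFun μ (l⁻¹ * s)‖ ∂(symmLaw unitUniform) := by
  have h := norm_integral_charFun_le μ (symmLaw unitUniform) a l⁻¹
  simp_rw [charFun_symmLaw unitUniform] at h
  rw [integral_complex_ofReal, Complex.norm_real, Real.norm_eq_abs] at h
  have h' := (le_abs_self _).trans h
  refine le_trans ?_ (mul_le_mul_of_nonneg_left h' (by norm_num))
  have hm : MeasurableSet (Set.Icc (a - l) (a + l)) := measurableSet_Icc
  have : μ.real (Set.Icc (a - l) (a + l))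
      = 4 * ∫ x, (Set.Icc (a - l) (a + l)).indicator (fun _ => (1 / 4 : ℝ)) x ∂μ := by
    rw [integral_indicator_const _ hm, smul_eq_mul]; ring
  rw [this]
  have hc : Continuous (charFun unitUniform) := by fun_prop
  gcongr
  · exact (integrable_const _).indicator hm
  · refine Integrable.of_bound (by fun_prop) 1 (.of_forall fun x => ?_)
    rw [norm_pow, norm_norm]
    exact pow_le_one₀ (norm_nonneg _) (norm_charFun_le_one _)
  · intro x
    dsimp only
    by_cases hx : x ∈ Set.Icc (a - l) (a + l)
    · rw [Set.indicator_of_mem hx]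
      have : |l⁻¹ * (x - a)| ≤ 1 := by
        rw [abs_mul, abs_of_pos (inv_pos.2 hl), inv_mul_le_one₀ hl, abs_le]
        constructor <;> linarith [hx.1, hx.2]
      have := half_le_norm_charFun_unitUniform this
      nlinarith
    · rw [Set.indicator_of_notMem hx]; positivity

theorem integral_exp_neg_one_sub_cos_le {N : ℝ} (hN : 0 < N) :
    ∫ u in (-Real.pi)..Real.pi, Real.exp (-N * (1 - Real.cos u)) ≤ 4 / √N := by
  have hb : 0 < 2 * N / Real.pi ^ 2 := by positivity
  have h1 : ∫ u in (-Real.pi)..Real.pi, Real.exp (-N * (1 - Real.cos u))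
      ≤ ∫ u : ℝ, Real.exp (-(2 * N / Real.pi ^ 2) * u ^ 2) := by
    rw [intervalIntegral.integral_of_le (by linarith [Real.pi_pos])]
    refine le_trans ?_ (setIntegral_le_integral (s := Set.Ioc (-Real.pi) Real.pi)
      (integrable_exp_neg_mul_sq hb) (.of_forall fun u => (Real.exp_pos _).le))
    refine setIntegral_mono_on (Continuous.integrableOn_Ioc (by fun_prop))
      (integrable_exp_neg_mul_sq hb).integrableOn measurableSet_Ioc fun u hu => ?_
    have := Real.cos_le_one_sub_mul_cos_sq (x := u) (abs_le.2 ⟨hu.1.le, hu.2⟩)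
    rw [Real.exp_le_exp]
    have h2 : N * (2 / Real.pi ^ 2 * u ^ 2) ≤ N * (1 - Real.cos u) := by gcongr; linarith
    calc -N * (1 - Real.cos u) ≤ -(N * (2 / Real.pi ^ 2 * u ^ 2)) := by linarith
      _ = _ := by ring
  refine h1.trans ?_
  rw [integral_gaussian, ← Real.sqrt_sq (show (0 : ℝ) ≤ 4 by norm_num), ← Real.sqrt_div (by norm_num)]
  refine Real.sqrt_le_sqrt ?_
  rw [div_div_eq_mul_div, div_le_div_iff₀ (by positivity) hN]
  have h3 : Real.pi ^ 3 ≤ 32 := by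
    calc Real.pi ^ 3 ≤ 3.15 ^ 3 := by gcongr; exact Real.pi_lt_d2.le
      _ ≤ 32 := by norm_num
  nlinarith

theorem integral_exp_neg_one_sub_cos_mul_le {N θ κ : ℝ} (hN : 0 < N) (hκ : 0 < κ) (hθ : κ ≤ |θ|)
    (t : ℝ) :
    ∫ s, Real.exp (-N * (1 - Real.cos ((s - t) * θ))) ∂unitUniform
      ≤ (1 + 1 / κ) * (4 / √N) := by
  wlog h0 : 0 < θ generalizing θ
  · have := this (θ := -θ) (by simpa using hθ)
      (by rcases (not_lt.1 h0).eq_or_lt with h | h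
          · simp [h] at hθ; linarith
          · linarith)
    simpa using this
  rw [abs_of_pos h0] at hθ
  have hp := Real.pi_pos
  set f : ℝ → ℝ := fun u => Real.exp (-N * (1 - Real.cos u)) with hf
  have hfc : Continuous f := by fun_prop
  have hper : Function.Periodic f (2 * Real.pi) := fun u => by simp [hf]
  set k : ℕ := ⌈θ / (2 * Real.pi)⌉₊
  have hk1 : θ ≤ k * (2 * Real.pi) := by
    rw [← div_le_iff₀ (by positivity)]; exact Nat.le_ceil _
  have hk2 : (k : ℝ) ≤ θ / (2 * Real.pi) + 1 := (Nat.ceil_lt_add_one (by positivity)).le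
  have hI : ∫ x in (-(t * θ))..(-(t * θ) + (k : ℤ) • (2 * Real.pi)), f x ≤ k * (4 / √N) := by
    rw [hper.intervalIntegral_add_zsmul_eq _ _ (fun _ _ => hfc.intervalIntegrable _ _),
      hper.intervalIntegral_add_eq _ (-Real.pi)]
    have := integral_exp_neg_one_sub_cos_le hN
    rw [show -Real.pi + 2 * Real.pi = Real.pi by ring, zsmul_eq_mul]
    push_cast
    gcongr
  have hJ : ∫ s, Real.exp (-N * (1 - Real.cos ((s - t) * θ))) ∂unitUniform
      = θ⁻¹ * ∫ x in (-(t * θ))..(-(t * θ) + θ), f x := by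
    rw [unitUniform, ← intervalIntegral.integral_of_le zero_le_one]
    have := intervalIntegral.integral_comp_mul_add (a := 0) (b := 1) f h0.ne' (-(t * θ))
    simp only [mul_zero, zero_add, mul_one, smul_eq_mul] at this
    rw [add_comm (-(t * θ)) θ, ← this]
    congr 1 with s
    simp only [hf]
    congr 4; ring
  rw [hJ]
  have hmono : ∫ x in (-(t * θ))..(-(t * θ) + θ), f x
      ≤ ∫ x in (-(t * θ))..(-(t * θ) + (k : ℤ) • (2 * Real.pi)), f x := by
    refine intervalIntegral.integral_mono_interval le_rfl (by linarith) ?_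
      (.of_forall fun u => (Real.exp_pos _).le) (hfc.intervalIntegrable _ _)
    rw [zsmul_eq_mul]; push_cast; linarith
  calc θ⁻¹ * ∫ x in (-(t * θ))..(-(t * θ) + θ), f x
      ≤ θ⁻¹ * ((θ / (2 * Real.pi) + 1) * (4 / √N)) := by
        gcongr
        exact hmono.trans (hI.trans (by gcongr))
    _ = (1 / (2 * Real.pi) + 1 / θ) * (4 / √N) := by field_simp
    _ ≤ _ := by
        gcongr
        rw [div_le_one (by positivity)]
        linarith [Real.pi_gt_three]

instance {E : Type*} [AddMonoid E] [MeasurableSpace E] [MeasurableAdd₂ E] (μ : Measure E)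
    [IsProbabilityMeasure μ] (n : ℕ) : IsProbabilityMeasure (convPow μ n) := by
  induction n with
  | zero => unfold convPow; infer_instance
  | succ n ih => unfold convPow; infer_instance

theorem charFun_convPow (μ : Measure ℝ) [IsProbabilityMeasure μ] (n : ℕ) (t : ℝ) :
    charFun (convPow μ n) t = charFun μ t ^ n := by
  induction n with
  | zero => simp [convPow]
  | succ n ih => rw [convPow, charFun_conv, ih, pow_succ]

theorem norm_charFun_pow_le_setAverage (μ : Measure ℝ) [IsProbabilityMeasure μ] (n : ℕ)
    {A : Set ℝ} (hA0 : symmLaw μ A ≠ 0) (t : ℝ) :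
    ‖charFun μ t‖ ^ n ≤ ⨍ x in A,
      Real.exp (-(n * (symmLaw μ).real A / 2) * (1 - Real.cos (t * x))) ∂(symmLaw μ) := by
  set ν := symmLaw μ
  have hp : 0 < ν.real A := ENNReal.toReal_pos hA0 (measure_ne_top _ _)
  have hb (x : ℝ) : ‖1 - Real.cos (t * x)‖ ≤ 2 := by
    rw [Real.norm_eq_abs, abs_le]
    constructor <;> linarith [Real.neg_one_le_cos (t * x), Real.cos_le_one (t * x)]
  have hn (x : ℝ) : 0 ≤ 1 - Real.cos (t * x) := by linarith [Real.cos_le_one (t * x)]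
  have hi : Integrable (fun x => 1 - Real.cos (t * x)) ν :=
    Integrable.of_bound (by fun_prop) 2 (.of_forall hb)
  set c : ℝ := n * ν.real A / 2 with hc
  have hJ := ConvexOn.map_set_average_le (μ := ν) (t := A) (s := Set.univ) (g := Real.exp)
    (f := fun x => -c * (1 - Real.cos (t * x)))
    convexOn_exp Real.continuous_exp.continuousOn isClosed_univ hA0 (measure_ne_top _ _)
    (by simp) (hi.const_mul _).integrableOn
    (by
      refine Integrable.of_bound (by fun_prop) 1 (.of_forall fun x => ?_)
      simp only [Function.comp]
      rw [Real.norm_eq_abs, Real.abs_exp, Real.exp_le_one_iff, neg_mul]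
      have := hn x
      have : 0 ≤ c := by positivity
      simp only [Left.neg_nonpos_iff]; positivity)
  refine le_trans ?_ hJ
  calc ‖charFun μ t‖ ^ n ≤ Real.exp (-(1 / 2) * ∫ x, (1 - Real.cos (t * x)) ∂ν) ^ n := by
        gcongr; exact norm_charFun_le_exp μ t
    _ = Real.exp (-(n / 2) * ∫ x, (1 - Real.cos (t * x)) ∂ν) := by
        rw [← Real.exp_nat_mul]; congr 1; ring
    _ ≤ _ := by
        rw [Real.exp_le_exp, setAverage_eq, integral_const_mul, smul_eq_mul]
        have h1 : ∫ x in A, (1 - Real.cos (t * x)) ∂ν ≤ ∫ x, (1 - Real.cos (t * x)) ∂ν :=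
          setIntegral_le_integral hi (.of_forall hn)
        have h2 : (ν.real A)⁻¹ * (-c * ∫ x in A, (1 - Real.cos (t * x)) ∂ν)
            = -(n / 2) * ∫ x in A, (1 - Real.cos (t * x)) ∂ν := by
          rw [hc]; field_simp
        rw [h2]
        have : (0 : ℝ) ≤ n / 2 := by positivity
        nlinarith

/-- A Kolmogorov–Rogozin inequality. -/
theorem convPow_real_Icc_le (μ : Measure ℝ) [IsProbabilityMeasure μ] {n : ℕ} (hn : 1 ≤ n)
    (a : ℝ) {l κ : ℝ} (hl : 0 < l) (hκ : 0 < κ)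
    (h0 : symmLaw μ {x | κ * l ≤ |x|} ≠ 0) :
    (convPow μ n).real (Set.Icc (a - l) (a + l))
      ≤ 4 * ((1 + 1 / κ) * (4 / √(n * (symmLaw μ).real {x | κ * l ≤ |x|} / 2))) := by
  have hA : MeasurableSet {x : ℝ | κ * l ≤ |x|} := measurableSet_le (by fun_prop) (by fun_prop)
  set A := {x : ℝ | κ * l ≤ |x|}
  set ν := symmLaw μ
  have hp : 0 < ν.real A := ENNReal.toReal_pos h0 (measure_ne_top _ _)
  set N : ℝ := n * ν.real A / 2
  have hN : 0 < N := by positivity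
  refine (measureReal_Icc_le_integral_charFun _ a hl).trans ?_
  gcongr
  simp_rw [charFun_convPow, norm_pow]
  set τ := symmLaw unitUniform with hτ
  have hle1 (s x : ℝ) : ‖Real.exp (-N * (1 - Real.cos (l⁻¹ * s * x)))‖ ≤ 1 := by
    rw [Real.norm_eq_abs, Real.abs_exp, Real.exp_le_one_iff, neg_mul]
    have := Real.cos_le_one (l⁻¹ * s * x)
    simp only [Left.neg_nonpos_iff]
    exact mul_nonneg hN.le (by linarith)
  have hint : Integrable (Function.uncurry fun s x => Real.exp (-N * (1 - Real.cos (l⁻¹ * s * x))))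
      (τ.prod (ν.restrict A)) :=
    Integrable.of_bound (by fun_prop) 1 (.of_forall fun p => hle1 p.1 p.2)
  have hc : Continuous (charFun μ) := by fun_prop
  calc ∫ s, ‖charFun μ (l⁻¹ * s)‖ ^ n ∂τ
      ≤ ∫ s, (ν.real A)⁻¹ * ∫ x in A, Real.exp (-N * (1 - Real.cos (l⁻¹ * s * x))) ∂ν ∂τ := by
        refine integral_mono ?_ (hint.integral_prod_left.const_mul _) fun s => ?_
        · refine Integrable.of_bound (by fun_prop) 1 (.of_forall fun x => ?_)
          rw [norm_pow, norm_norm]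
          exact pow_le_one₀ (norm_nonneg _) (norm_charFun_le_one _)
        · have := norm_charFun_pow_le_setAverage μ n h0 (l⁻¹ * s)
          rwa [setAverage_eq, smul_eq_mul] at this
    _ = (ν.real A)⁻¹ * ∫ x in A, ∫ s, Real.exp (-N * (1 - Real.cos (l⁻¹ * s * x))) ∂τ ∂ν := by
        rw [integral_const_mul, integral_integral_swap hint]
    _ ≤ (ν.real A)⁻¹ * ∫ x in A, (1 + 1 / κ) * (4 / √N) ∂ν := by
        have hr : IntegrableOn (fun x => ∫ s, Real.exp (-N * (1 - Real.cos (l⁻¹ * s * x))) ∂τ) A ν :=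
          hint.integral_prod_right
        refine mul_le_mul_of_nonneg_left ?_ (inv_nonneg.2 hp.le)
        refine setIntegral_mono_on hr (integrable_const _) hA fun x hx => ?_
        rw [hτ, symmLaw, integral_map (by fun_prop) (by fun_prop)]
        rw [integral_prod_symm]
        · have hθ : κ ≤ |l⁻¹ * x| := by
            rw [abs_mul, abs_of_pos (inv_pos.2 hl), inv_mul_eq_div, le_div_iff₀ hl]; exact hx
          have hh (t : ℝ) : ∫ s, Real.exp (-N * (1 - Real.cos (l⁻¹ * (s - t) * x))) ∂unitUniform
              ≤ (1 + 1 / κ) * (4 / √N) := by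
            have := integral_exp_neg_one_sub_cos_mul_le hN hκ hθ t
            refine le_trans (le_of_eq ?_) this
            congr 1 with s
            congr 4; ring
          refine (integral_mono_of_nonneg (.of_forall fun t => integral_nonneg
            fun s => (Real.exp_pos _).le) (integrable_const _) (.of_forall hh)).trans ?_
          simp
        · exact Integrable.of_bound (by fun_prop) 1 (.of_forall fun p => hle1 _ _)
    _ = _ := by
        rw [setIntegral_const, smul_eq_mul, ← mul_assoc, inv_mul_cancel₀ hp.ne', one_mul]

theorem isDegenerate_of_symmLaw_eq_zero (μ : Measure ℝ) [IsProbabilityMeasure μ]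
    (h : symmLaw μ {0}ᶜ = 0) : IsDegenerate μ := by
  rw [symmLaw, Measure.map_apply (by fun_prop) (measurableSet_singleton _).compl] at h
  have h1 : ∀ᵐ p ∂(μ.prod μ), p.1 - p.2 = 0 := by
    rw [ae_iff]; exact h
  obtain ⟨a, ha⟩ := (Measure.ae_ae_of_ae_prod h1).exists
  refine ⟨a, ?_⟩
  have h2 : (fun y => y) =ᵐ[μ] fun _ => a := by
    filter_upwards [ha] with y hy
    linarith
  calc μ = μ.map (fun y => y) := Measure.map_id.symm
    _ = μ.map fun _ => a := Measure.map_congr h2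
    _ = Measure.dirac a := by simp

theorem exists_symmLaw_abs_ge_ne_zero (μ : Measure ℝ) [IsProbabilityMeasure μ]
    (h : ¬ IsDegenerate μ) : ∃ δ : ℝ, 0 < δ ∧ symmLaw μ {x | δ ≤ |x|} ≠ 0 := by
  by_contra! hc
  refine h (isDegenerate_of_symmLaw_eq_zero μ ?_)
  have : ({0}ᶜ : Set ℝ) ⊆ ⋃ k : ℕ, {x : ℝ | 1 / ((k : ℝ) + 1) ≤ |x|} := by
    intro x hx
    obtain ⟨k, hk⟩ := exists_nat_one_div_lt (abs_pos.2 hx)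
    exact Set.mem_iUnion.2 ⟨k, hk.le⟩
  exact measure_mono_null this (measure_iUnion_null fun k => hc _ (by positivity))

theorem exists_measure_abs_le_ge_half (μ : Measure ℝ) [IsProbabilityMeasure μ] :
    ∃ L : ℝ, 0 < L ∧ 1 / 2 ≤ μ {x | |x| ≤ L} := by
  have hu : (⋃ k : ℕ, {x : ℝ | |x| ≤ k}) = Set.univ :=
    Set.eq_univ_of_forall fun x => Set.mem_iUnion.2 (exists_nat_ge |x|)
  have hm : Monotone fun k : ℕ => {x : ℝ | |x| ≤ k} := fun i j hij x hx =>
    le_trans (b := (i : ℝ)) hx (by exact_mod_cast hij)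
  have ht := tendsto_measure_iUnion_atTop (μ := μ) hm
  rw [hu, measure_univ] at ht
  have hlt : (1 / 2 : ENNReal) < 1 := by
    rw [one_div]; exact ENNReal.one_half_lt_one
  obtain ⟨k, hk, hk1⟩ := ((ht.eventually_const_le hlt).and (Filter.eventually_ge_atTop 1)).exists
  exact ⟨k, by exact_mod_cast hk1, hk⟩

/-- The tails of the symmetrization of a non-degenerate law dominate the tails of the law. -/
theorem exists_tail_le_symmLaw (μ : Measure ℝ) [IsProbabilityMeasure μ] (h : ¬ IsDegenerate μ) :
    ∃ κ c : ℝ, 0 < κ ∧ 0 < c ∧ ∀ l : ℝ, 0 < l →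
      c * μ.real {x | l ≤ |x|} ≤ (symmLaw μ).real {x | κ * l ≤ |x|} := by
  obtain ⟨δ, hδ, hp⟩ := exists_symmLaw_abs_ge_ne_zero μ h
  obtain ⟨L, hL, hL2⟩ := exists_measure_abs_le_ge_half μ
  set p := (symmLaw μ).real {x | δ ≤ |x|}
  have hp0 : 0 < p := ENNReal.toReal_pos hp (measure_ne_top _ _)
  have hL2' : 1 / 2 ≤ μ.real {x | |x| ≤ L} := by
    have := ENNReal.toReal_mono (measure_ne_top μ _) hL2
    simpa [Measure.real] using this
  refine ⟨min (1 / 2) (δ / (2 * L)), min (1 / 2) p, by positivity, by positivity, fun l hl => ?_⟩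
  have hU : 0 ≤ μ.real {x | l ≤ |x|} := measureReal_nonneg
  rcases le_total (2 * L) l with hlL | hlL
  · calc min (1 / 2) p * μ.real {x | l ≤ |x|}
        ≤ μ.real {x | l ≤ |x|} * μ.real {x | |x| ≤ L} := by
          rw [mul_comm]
          gcongr
          exact (min_le_left _ _).trans hL2'
      _ = (μ.prod μ).real ({x | l ≤ |x|} ×ˢ {x | |x| ≤ L}) := by rw [measureReal_prod_prod]
      _ ≤ (μ.prod μ).real ((fun p : ℝ × ℝ => p.1 - p.2) ⁻¹'
            {x | min (1 / 2) (δ / (2 * L)) * l ≤ |x|}) := by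
          refine measureReal_mono ?_
          rintro ⟨x, y⟩ ⟨hx, hy⟩
          simp only [Set.mem_ofPred_eq, Set.mem_preimage] at hx hy ⊢
          have h1 := abs_sub_abs_le_abs_sub x y
          have h2 : min (1 / 2) (δ / (2 * L)) * l ≤ 1 / 2 * l := by
            gcongr; exact min_le_left _ _
          linarith
      _ = _ := by
          rw [symmLaw, map_measureReal_apply (by fun_prop)
            (measurableSet_le (by fun_prop) (by fun_prop))]
  · calc min (1 / 2) p * μ.real {x | l ≤ |x|} ≤ p * 1 := by
          gcongr
          · exact min_le_right _ _
          · exact measureReal_le_one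
      _ = p := mul_one p
      _ ≤ _ := by
          refine measureReal_mono fun x hx => ?_
          simp only [Set.mem_ofPred_eq] at hx ⊢
          refine le_trans ?_ hx
          calc min (1 / 2) (δ / (2 * L)) * l ≤ δ / (2 * L) * (2 * L) := by
                gcongr; exact min_le_right _ _
            _ = δ := by field_simp

theorem antitone_measure_abs_ge (μ : Measure ℝ) : Antitone fun l : ℝ => μ {y | l ≤ |y|} :=
  fun _ _ hab => measure_mono fun _ hy => le_trans hab hy

theorem measurable_measure_abs_ge_abs (μ : Measure ℝ) :
    Measurable fun x : ℝ => μ {y | |x| ≤ |y|} :=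
  (antitone_measure_abs_ge μ).measurable.comp measurable_abs

/-- The tail function evaluated at the random variable itself is stochastically larger than a
uniform variable. -/
theorem measure_tail_le_le (μ : Measure ℝ) [IsFiniteMeasure μ] (u : ENNReal) :
    μ {x | μ {y | |x| ≤ |y|} ≤ u} ≤ u := by
  have hm : MeasurableSet {x | μ {y | |x| ≤ |y|} ≤ u} :=
    measurableSet_le (measurable_measure_abs_ge_abs μ) measurable_const
  rw [hm.measure_eq_iSup_isCompact]
  refine iSup₂_le fun K hK => iSup_le fun hKc => ?_
  rcases K.eq_empty_or_nonempty with rfl | hne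
  · simp
  obtain ⟨x, hx, hmin⟩ := hKc.exists_isMinOn hne continuous_abs.continuousOn
  exact (measure_mono fun y hy => hmin hy).trans (hK hx)

theorem lintegral_tail_rpow_neg_half_ne_top (μ : Measure ℝ) [IsProbabilityMeasure μ] :
    ∫⁻ x, (μ {y | |x| ≤ |y|}) ^ (-(1 / 2) : ℝ) ∂μ ≠ ⊤ := by
  set V : ℝ → ENNReal := fun x => μ {y | |x| ≤ |y|} with hV
  set S : ℕ → Set ℝ := fun k => {x | V x ≤ ENNReal.ofReal ((1 / 4) ^ k)} with hS
  have hSm (k : ℕ) : MeasurableSet (S k) :=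
    measurableSet_le (measurable_measure_abs_ge_abs μ) measurable_const
  have hpos : ∀ᵐ x ∂μ, V x ≠ 0 := by
    rw [ae_iff]
    have := measure_tail_le_le μ 0
    simpa using this
  have hle : ∀ᵐ x ∂μ, V x ^ (-(1 / 2) : ℝ)
      ≤ ∑' k, (S k).indicator (fun _ => ENNReal.ofReal (2 ^ (k + 1))) x := by
    filter_upwards [hpos] with x hx
    have hv0 : 0 < (V x).toReal := ENNReal.toReal_pos hx (measure_ne_top _ _)
    have hv1 : (V x).toReal ≤ 1 := measureReal_le_one
    obtain ⟨k, hk1, hk2⟩ := exists_nat_pow_near_of_lt_one hv0 hv1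
      (show (0 : ℝ) < 1 / 4 by norm_num) (by norm_num)
    refine le_trans ?_ (ENNReal.le_tsum k)
    have hVx : V x = ENNReal.ofReal (V x).toReal := (ENNReal.ofReal_toReal (measure_ne_top _ _)).symm
    rw [Set.indicator_of_mem (by
      change V x ≤ _
      rw [hVx]; exact ENNReal.ofReal_le_ofReal hk2), hVx, ENNReal.ofReal_rpow_of_pos hv0]
    refine ENNReal.ofReal_le_ofReal ?_
    rw [Real.rpow_neg hv0.le, ← Real.sqrt_eq_rpow]
    refine inv_le_of_inv_le₀ (by positivity) (Real.le_sqrt_of_sq_le ?_)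
    refine le_trans (le_of_eq ?_) hk1.le
    rw [← inv_pow, ← pow_mul, mul_comm, pow_mul]; norm_num
  refine ne_top_of_le_ne_top ?_ (lintegral_mono_ae hle)
  rw [lintegral_tsum fun k => (measurable_const.indicator (hSm k)).aemeasurable]
  have hsum : Summable fun k : ℕ => 2 * (1 / 2 : ℝ) ^ k := summable_geometric_two.mul_left 2
  refine ne_top_of_le_ne_top hsum.tsum_ofReal_ne_top (ENNReal.tsum_le_tsum fun k => ?_)
  rw [lintegral_indicator_const (hSm k)]
  refine (mul_le_mul_right (measure_tail_le_le μ _) _).trans (le_of_eq ?_)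
  rw [← ENNReal.ofReal_mul (by positivity), pow_succ, mul_comm _ (2 : ℝ), mul_assoc, ← mul_pow]
  norm_num

/-- A bound on the concentration of the convolution powers of a non-degenerate law at the scale of
an independent copy of a summand. -/
theorem exists_convPow_Icc_le (μ : Measure ℝ) [IsProbabilityMeasure μ]
    (h : ¬ IsDegenerate μ ∨ μ = Measure.dirac 0) :
    ∃ g : ℝ → ENNReal, Measurable g ∧ ∫⁻ x, g x ∂μ ≠ ⊤ ∧
      ∀ n : ℕ, 1 ≤ n → ∀ x : ℝ, x ≠ 0 → ∀ a : ℝ,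
        convPow μ n (Set.Icc (a - |x|) (a + |x|)) ≤ g x * ENNReal.ofReal ((n : ℝ) ^ (-(1 / 2) : ℝ)) := by
  rcases h with h | h
  · obtain ⟨κ, c, hκ, hc, hle⟩ := exists_tail_le_symmLaw μ h
    set C : ℝ := 4 * ((1 + 1 / κ) * 4) * (c / 2) ^ (-(1 / 2) : ℝ) with hC
    refine ⟨fun x => ENNReal.ofReal C * (μ {y | |x| ≤ |y|}) ^ (-(1 / 2) : ℝ),
      ((measurable_measure_abs_ge_abs μ).pow_const _).const_mul _, ?_, fun n hn x hx a => ?_⟩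
    · rw [lintegral_const_mul _ ((measurable_measure_abs_ge_abs μ).pow_const _)]
      exact ENNReal.mul_ne_top ENNReal.ofReal_ne_top (lintegral_tail_rpow_neg_half_ne_top μ)
    have hn0 : (0 : ℝ) < n := by exact_mod_cast hn
    have hC0 : 0 < C := by positivity
    dsimp only
    by_cases hU : μ {y | |x| ≤ |y|} = 0
    · rw [hU, ENNReal.zero_rpow_of_neg (by norm_num), ENNReal.mul_top (by simpa using hC0),
        ENNReal.top_mul (by simp only [ne_eq, ENNReal.ofReal_eq_zero, not_le]; positivity)]
      exact le_top
    have hU0 : 0 < μ.real {y | |x| ≤ |y|} := ENNReal.toReal_pos hU (measure_ne_top _ _)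
    have hx0 : 0 < |x| := abs_pos.2 hx
    have hle' := hle |x| hx0
    set V := (symmLaw μ).real {y | κ * |x| ≤ |y|} with hV
    set U := μ.real {y | |x| ≤ |y|} with hUdef
    have hV0 : 0 < V := lt_of_lt_of_le (by positivity) hle'
    have hkr := convPow_real_Icc_le μ hn a hx0 hκ
      (fun h0 => by rw [hV, Measure.real, h0] at hV0; simp at hV0)
    rw [← hV] at hkr
    rw [← ofReal_measureReal (μ := μ) (s := {y | |x| ≤ |y|}), ENNReal.ofReal_rpow_of_pos hU0,
      ← ENNReal.ofReal_mul hC0.le, ← ENNReal.ofReal_mul (by positivity),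
      ← ofReal_measureReal]
    refine ENNReal.ofReal_le_ofReal (hkr.trans ?_)
    have h1 : √(n * (c * U) / 2) ≤ √(n * V / 2) := by gcongr
    have h2 : 1 / √(n * (c * U) / 2)
        = (c / 2) ^ (-(1 / 2) : ℝ) * U ^ (-(1 / 2) : ℝ) * (n : ℝ) ^ (-(1 / 2) : ℝ) := by
      rw [← Real.mul_rpow (by positivity) (by positivity),
        ← Real.mul_rpow (by positivity) (by positivity), Real.rpow_neg (by positivity),
        ← Real.sqrt_eq_rpow, one_div]
      congr 2; ring
    calc 4 * ((1 + 1 / κ) * (4 / √(n * V / 2)))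
        ≤ 4 * ((1 + 1 / κ) * (4 / √(n * (c * U) / 2))) := by gcongr
      _ = 4 * ((1 + 1 / κ) * 4) * (1 / √(n * (c * U) / 2)) := by ring
      _ = _ := by rw [h2, hC]; ring
  · refine ⟨Set.indicator {0}ᶜ fun _ => ⊤,
      measurable_const.indicator (measurableSet_singleton _).compl, by simp [h], fun n hn x hx a => ?_⟩
    have hn0 : (0 : ℝ) < n := by exact_mod_cast hn
    rw [Set.indicator_of_mem (by simpa using hx),
      ENNReal.top_mul (by simp only [ne_eq, ENNReal.ofReal_eq_zero, not_le]; positivity)]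
    exact le_top

/-- If exactly one of `y` and `y + x` lies in an interval, then `y` is within `|x|` of an
endpoint. -/
theorem mem_Icc_or_mem_Icc_of_not_iff {a b : EReal} {y x : ℝ}
    (h : ¬ ((a ≤ (y : EReal) ∧ (y : EReal) ≤ b) ↔
      (a ≤ ((y + x : ℝ) : EReal) ∧ ((y + x : ℝ) : EReal) ≤ b))) :
    y ∈ Set.Icc (a.toReal - |x|) (a.toReal + |x|)
      ∨ y ∈ Set.Icc (b.toReal - |x|) (b.toReal + |x|) := by
  by_contra! hc
  simp only [Set.mem_Icc, not_and_or, not_le] at hc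
  have h1 := le_abs_self x
  have h2 := neg_abs_le x
  have key (e : ℝ) (he : y < e - |x| ∨ e + |x| < y) : (e ≤ y ↔ e ≤ y + x) ∧ (y ≤ e ↔ y + x ≤ e) := by
    rcases he with he | he
    · exact ⟨⟨fun _ => by linarith, fun _ => by linarith⟩,
        ⟨fun _ => by linarith, fun _ => by linarith⟩⟩
    · exact ⟨⟨fun _ => by linarith, fun _ => by linarith⟩,
        ⟨fun _ => by linarith, fun _ => by linarith⟩⟩
  have ha : a ≤ (y : EReal) ↔ a ≤ ((y + x : ℝ) : EReal) := by
    induction a with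
    | bot => simp
    | top => simp only [top_le_iff, EReal.coe_ne_top]
    | coe e => simpa only [EReal.coe_le_coe_iff] using (key e hc.1).1
  have hb : (y : EReal) ≤ b ↔ ((y + x : ℝ) : EReal) ≤ b := by
    induction b with
    | bot => simp only [le_bot_iff, EReal.coe_ne_bot]
    | top => simp
    | coe e => simpa only [EReal.coe_le_coe_iff] using (key e hc.2).2
  exact h (and_congr ha hb)

section Polyhedra

variable {d m : ℕ}

theorem projLaw_convPow (F : Measure (EuclideanSpace ℝ (Fin d))) [IsProbabilityMeasure F]
    (t : EuclideanSpace ℝ (Fin d)) (n : ℕ) :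
    projLaw (convPow F n) t = convPow (projLaw F t) n := by
  have hL (μ : Measure (EuclideanSpace ℝ (Fin d))) : projLaw μ t = μ.map (innerSL ℝ t) := by
    unfold projLaw
    congr 1 with x
    exact real_inner_comm _ _
  induction n with
  | zero => rw [hL, convPow, convPow, Measure.map_dirac' (innerSL ℝ t).measurable, map_zero]
  | succ n ih =>
    rw [convPow, convPow, ← ih, hL, hL, hL]
    exact Measure.map_conv_continuousLinearMap _

instance (F : Measure (EuclideanSpace ℝ (Fin d))) [IsProbabilityMeasure F]
    (t : EuclideanSpace ℝ (Fin d)) : IsProbabilityMeasure (projLaw F t) :=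
  Measure.isProbabilityMeasure_map (by fun_prop)

theorem measurableSet_of_mem_polyhedra {t : Fin m → EuclideanSpace ℝ (Fin d)}
    {X : Set (EuclideanSpace ℝ (Fin d))} (hX : X ∈ polyhedra t) : MeasurableSet X := by
  obtain ⟨a, b, -, rfl⟩ := hX
  have hm (j : Fin m) : Measurable fun x : EuclideanSpace ℝ (Fin d) =>
      ((inner ℝ x (t j) : ℝ) : EReal) := measurable_coe_real_ereal.comp (by fun_prop)
  rw [Set.ofPred_forall]
  exact .iInter fun j => (measurableSet_le measurable_const (hm j)).inter
    (measurableSet_le (hm j) measurable_const)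

/-- The convolution powers charge the symmetric difference of a polyhedron and its translate
little. -/
theorem exists_convPow_symmDiff_le (F : Measure (EuclideanSpace ℝ (Fin d)))
    [IsProbabilityMeasure F] (t : Fin m → EuclideanSpace ℝ (Fin d))
    (hF : ∀ j, ¬ IsDegenerate (projLaw F (t j)) ∨ projLaw F (t j) = Measure.dirac 0) :
    ∃ G : EuclideanSpace ℝ (Fin d) → ENNReal, Measurable G ∧ ∫⁻ x, G x ∂F ≠ ⊤ ∧
      ∀ n : ℕ, 1 ≤ n → ∀ X ∈ polyhedra t, ∀ x,
        convPow F n {y | ¬ (y ∈ X ↔ y + x ∈ X)}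
          ≤ G x * ENNReal.ofReal ((n : ℝ) ^ (-(1 / 2) : ℝ)) := by
  choose g hgm hgi hg using fun j => exists_convPow_Icc_le (projLaw F (t j)) (hF j)
  have hm (j : Fin m) : Measurable fun x : EuclideanSpace ℝ (Fin d) => g j (inner ℝ x (t j)) :=
    (hgm j).comp (by fun_prop)
  refine ⟨fun x => ∑ j, 2 * g j (inner ℝ x (t j)),
    Finset.measurable_sum _ fun j _ => (hm j).const_mul _, ?_, ?_⟩
  · rw [lintegral_finsetSum _ fun j _ => (hm j).const_mul _]
    refine ENNReal.sum_ne_top.2 fun j _ => ?_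
    rw [lintegral_const_mul _ (hm j)]
    refine ENNReal.mul_ne_top (by simp) ?_
    have := hgi j
    rwa [projLaw, lintegral_map (hgm j) (by fun_prop)] at this
  rintro n hn X ⟨a, b, -, rfl⟩ x
  set r := ENNReal.ofReal ((n : ℝ) ^ (-(1 / 2) : ℝ))
  set I : Fin m → EuclideanSpace ℝ (Fin d) → Prop := fun j y =>
    a j ≤ ((inner ℝ y (t j) : ℝ) : EReal) ∧ ((inner ℝ y (t j) : ℝ) : EReal) ≤ b j with hI
  have hsub : {y | ¬ ((∀ j, I j y) ↔ ∀ j, I j (y + x))} ⊆ ⋃ j, {y | ¬ (I j y ↔ I j (y + x))} := by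
    intro y hy
    by_contra hc
    simp only [Set.mem_iUnion, Set.mem_ofPred_eq, not_exists, not_not] at hc
    exact hy (forall_congr' hc)
  refine (measure_mono hsub).trans ((measure_iUnion_fintype_le _ _).trans ?_)
  rw [Finset.sum_mul]
  refine Finset.sum_le_sum fun j _ => ?_
  set z : ℝ := inner ℝ x (t j) with hz
  have hadd (y : EuclideanSpace ℝ (Fin d)) : inner ℝ (y + x) (t j) = inner ℝ y (t j) + z :=
    inner_add_left _ _ _
  by_cases hz0 : z = 0
  · have : {y | ¬ (I j y ↔ I j (y + x))} = ∅ := by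
      refine Set.eq_empty_of_forall_notMem fun y hy => hy ?_
      simp only [hI, hadd, hz0, add_zero]
    simp [this]
  have hc (e : ℝ) : convPow F n {y | inner ℝ y (t j) ∈ Set.Icc (e - |z|) (e + |z|)} ≤ g j z * r := by
    have := hg j n hn z hz0 e
    rwa [← projLaw_convPow, projLaw, Measure.map_apply (by fun_prop) measurableSet_Icc] at this
  have hsub2 : {y | ¬ (I j y ↔ I j (y + x))}
      ⊆ {y | inner ℝ y (t j) ∈ Set.Icc ((a j).toReal - |z|) ((a j).toReal + |z|)}
        ∪ {y | inner ℝ y (t j) ∈ Set.Icc ((b j).toReal - |z|) ((b j).toReal + |z|)} := by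
    intro y hy
    refine mem_Icc_or_mem_Icc_of_not_iff (a := a j) (b := b j) (x := z) ?_
    rw [← hadd]
    exact hy
  calc _ ≤ _ := measure_mono hsub2
    _ ≤ _ := measure_union_le _ _
    _ ≤ g j z * r + g j z * r := add_le_add (hc _) (hc _)
    _ = _ := by rw [mul_assoc, two_mul]

theorem convPow_succ_apply (F : Measure (EuclideanSpace ℝ (Fin d))) [IsProbabilityMeasure F]
    (n : ℕ) {X : Set (EuclideanSpace ℝ (Fin d))} (hX : MeasurableSet X) :
    convPow F (n + 1) X = ∫⁻ x, convPow F n {y | y + x ∈ X} ∂F := by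
  rw [convPow, Measure.conv, Measure.map_apply (by fun_prop) hX,
    Measure.prod_apply_symm (measurable_add hX)]
  rfl

end Polyhedra

theorem theorem5 {d m : ℕ} (F : Measure (EuclideanSpace ℝ (Fin d))) [IsProbabilityMeasure F]
    (t : Fin m → EuclideanSpace ℝ (Fin d))
    (hF : ∀ j, ¬ IsDegenerate (projLaw F (t j)) ∨ projLaw F (t j) = Measure.dirac 0) :
    ∃ c : ℝ, 0 < c ∧ ∀ n : ℕ, 1 ≤ n → ∀ X ∈ polyhedra t,
      |(convPow F n).real X - (convPow F (n + 1)).real X| ≤ c * (n : ℝ) ^ (-(1 / 2 : ℝ)) := by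
  obtain ⟨G, hGm, hGi, hG⟩ := exists_convPow_symmDiff_le F t hF
  refine ⟨(∫⁻ x, G x ∂F).toReal + 1, by positivity, fun n hn X hX => ?_⟩
  have hXm := measurableSet_of_mem_polyhedra hX
  set r : ℝ := (n : ℝ) ^ (-(1 / 2 : ℝ)) with hr
  have hr0 : 0 ≤ r := by positivity
  have hint : ∫⁻ x, G x * ENNReal.ofReal r ∂F = (∫⁻ x, G x ∂F) * ENNReal.ofReal r :=
    lintegral_mul_const _ hGm
  have hconst : ∫⁻ _, convPow F n X ∂F = convPow F n X := by simp
  have hmeas : Measurable fun x => G x * ENNReal.ofReal r := hGm.mul_const _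
  have h1 : convPow F n X ≤ convPow F (n + 1) X + (∫⁻ x, G x ∂F) * ENNReal.ofReal r := by
    rw [convPow_succ_apply F n hXm, ← hint, ← lintegral_add_right _ hmeas, ← hconst]
    refine lintegral_mono fun x => ?_
    refine le_trans ?_ (add_le_add_right (hG n hn X hX x) _)
    refine le_trans (measure_mono fun y hy => ?_) (measure_union_le _ _)
    by_cases h : y + x ∈ X
    · exact Or.inl h
    · exact Or.inr fun hiff => h (hiff.1 hy)
  have h2 : convPow F (n + 1) X ≤ convPow F n X + (∫⁻ x, G x ∂F) * ENNReal.ofReal r := by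
    rw [convPow_succ_apply F n hXm, ← hint, ← hconst, ← lintegral_add_right _ hmeas]
    refine lintegral_mono fun x => ?_
    refine le_trans ?_ (add_le_add_right (hG n hn X hX x) _)
    refine le_trans (measure_mono fun y hy => ?_) (measure_union_le _ _)
    by_cases h : y ∈ X
    · exact Or.inl h
    · exact Or.inr fun hiff => h (hiff.2 hy)
  have htop : (∫⁻ x, G x ∂F) * ENNReal.ofReal r ≠ ⊤ := ENNReal.mul_ne_top hGi ENNReal.ofReal_ne_top
  have key {p q : ENNReal} (hq : q ≠ ⊤)
      (h : p ≤ q + (∫⁻ x, G x ∂F) * ENNReal.ofReal r) :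
      p.toReal - q.toReal ≤ (∫⁻ x, G x ∂F).toReal * r := by
    have := ENNReal.toReal_mono (ENNReal.add_ne_top.2 ⟨hq, htop⟩) h
    rw [ENNReal.toReal_add hq htop, ENNReal.toReal_mul, ENNReal.toReal_ofReal hr0] at this
    linarith
  have k1 := key (measure_ne_top _ _) h1
  have k2 := key (measure_ne_top _ _) h2
  rw [abs_le]
  simp only [Measure.real]
  constructor <;> linarith
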